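/- Call a group $G$ subgroup conjugacy separable if, for every pair of non-conjugate finitely generated subgroups $H$ and $K$ of $G$, there is a normal subgroup $N$ of finite index in $G$ such that the images of $H$ and $K$ in the finite quotient $G/N$ are not conjugate in $G/N$. Let $F_2$ denote the free group of rank $2$. Then the direct product $F_2\times F_2$ is not subgroup conjugacy separable. -/

import Mathlib

/-- Two subgroups `H` and `K` of a group `G` are conjugate in `G` if `K = g H g⁻¹` for some `g` in `G`. -/
def SubgroupsConjugate {G : Type*} [Group G] (H K : Subgroup G) : Prop :=
  ∃ g : G, K = H.map (MulAut.conj g).toMonoidHom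

/-- A group `G` is subgroup conjugacy separable if for every pair of non-conjugate finitely
generated subgroups `H` and `K` of `G` there is a finite quotient `G ⧸ N` of `G` (so `N` is a normal
subgroup of finite index) in which the images of `H` and `K` are not conjugate. -/
def SubgroupConjugacySeparable (G : Type*) [Group G] : Prop :=
  ∀ H K : Subgroup G, H.FG → K.FG → ¬ SubgroupsConjugate H K →
    ∃ (N : Subgroup G) (_ : N.Normal), Finite (G ⧸ N) ∧
      ¬ SubgroupsConjugate (H.map (QuotientGroup.mk' N)) (K.map (QuotientGroup.mk' N))

/-! BS(2,3) is not residually finite: some word w ≠ 1 in it dies in every finite quotient. Let P be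
the fibre product of F₂ → BS(2,3) with itself, generated by the diagonal and (relator, 1). P and ⟨P,
(w, 1)⟩ have equal images in every finite quotient (`map_residualFibreProduct`), but only the second
contains (w, 1), even up to conjugacy. -/

/-- In a finite group the Baumslag–Solitar relation `y x² y⁻¹ = x³` forces `y x y⁻¹` to commute
with `x`. -/
theorem commute_conj_of_conj_sq_eq_cube {G : Type*} [Group G] [Finite G] {x y : G}
    (h : y * x ^ 2 * y⁻¹ = x ^ 3) : Commute (y * x * y⁻¹) x := by
  have hn : 0 < orderOf x := orderOf_pos x
  have hord : orderOf x / (orderOf x).gcd 2 = orderOf x / (orderOf x).gcd 3 := by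
    rw [← orderOf_pow, ← orderOf_pow, ← h]
    exact (orderOf_injective (MulAut.conj y).toMonoidHom (MulAut.conj y).injective (x ^ 2)).symm
  -- For even order, `hord` would force gcd(n, 3) = 2.
  have hcop : Nat.Coprime 2 (orderOf x) := by
    rw [Nat.coprime_two_left, ← Nat.not_even_iff_odd, even_iff_two_dvd]
    intro h2
    rw [Nat.gcd_eq_right h2] at hord
    rcases (Nat.dvd_prime Nat.prime_three).1 (Nat.gcd_dvd_right (orderOf x) 3) with h1 | h1
    · rw [h1] at hord
      omega
    · have h3 : 3 ∣ orderOf x := h1 ▸ Nat.gcd_dvd_left (orderOf x) 3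
      rw [h1] at hord
      omega
  obtain ⟨m, hm⟩ := exists_pow_eq_self_of_coprime hcop
  have hconj : y * x * y⁻¹ = (x ^ 3) ^ m := by
    rw [← h, conj_pow, hm]
  rw [hconj]
  exact ((Commute.refl x).pow_left 3).pow_left m

/-- The translation `(n, i) ↦ (n + 1, i)` of `ℤ × ℤ`. -/
def translationPerm : Equiv.Perm (ℤ × ℤ) where
  toFun p := (p.1 + 1, p.2)
  invFun p := (p.1 - 1, p.2)
  left_inv p := by simp
  right_inv p := by simp

/-- A permutation of `ℤ × ℤ` that matches the orbits of the square of the translation with the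
orbits of its cube. -/
def orbitMatchingPerm : Equiv.Perm (ℤ × ℤ) where
  -- Orbits of the square get index 2i + n % 2, those of the cube 3i + n % 3; index and position are
  -- kept.
  toFun p := (3 * (p.1 / 2) + (2 * p.2 + p.1 % 2) % 3, (2 * p.2 + p.1 % 2) / 3)
  invFun p := (2 * (p.1 / 3) + (3 * p.2 + p.1 % 3) % 2, (3 * p.2 + p.1 % 3) / 2)
  left_inv p := by
    ext <;> dsimp only <;> omega
  right_inv p := by
    ext <;> dsimp only <;> omega

theorem orbitMatchingPerm_conj_sq :
    orbitMatchingPerm * translationPerm ^ 2 * orbitMatchingPerm⁻¹ = translationPerm ^ 3 := by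
  rw [mul_inv_eq_iff_eq_mul]
  ext p <;> simp only [pow_succ, pow_zero, one_mul, Equiv.Perm.mul_apply] <;>
    simp only [orbitMatchingPerm, translationPerm, Equiv.coe_fn_mk] <;> omega

theorem not_commute_orbitMatchingPerm_conj :
    ¬ Commute (orbitMatchingPerm * translationPerm * orbitMatchingPerm⁻¹) translationPerm := by
  intro h
  -- The two products send (0, 0) to (3, 0) and (2, 0).
  have h0 := congrArg (fun σ : Equiv.Perm (ℤ × ℤ) => σ (0, 0)) h.eq
  revert h0
  decide

namespace BaumslagSolitar

/-- The first generator of the free group of rank two. -/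
abbrev a : FreeGroup (Fin 2) := FreeGroup.of 0

/-- The second generator, playing the role of the stable letter. -/
abbrev t : FreeGroup (Fin 2) := FreeGroup.of 1

/-- The relator of the Baumslag–Solitar group `BS(2, 3)`. -/
def relator : FreeGroup (Fin 2) := t * a ^ 2 * t⁻¹ * (a ^ 3)⁻¹

open scoped commutatorElement in
/-- A word that is nontrivial in `BS(2, 3)` but trivial in all its finite quotients. -/
def residualWord : FreeGroup (Fin 2) := ⁅t * a * t⁻¹, a⁆

/-- The subgroup of pairs of words with the same value in `BS(2, 3)`, by its generators. -/
def fibreProduct : Subgroup (FreeGroup (Fin 2) × FreeGroup (Fin 2)) :=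
  Subgroup.closure {(a, a), (t, t), (relator, 1)}

/-- The fibre product over the quotient of `BS(2, 3)` by the residual word. -/
def residualFibreProduct : Subgroup (FreeGroup (Fin 2) × FreeGroup (Fin 2)) :=
  fibreProduct ⊔ Subgroup.closure {(residualWord, 1)}

theorem fibreProduct_fg : fibreProduct.FG :=
  ⟨{(a, a), (t, t), (relator, 1)}, by simp [fibreProduct]⟩

theorem residualFibreProduct_fg : residualFibreProduct.FG :=
  fibreProduct_fg.sup ⟨{(residualWord, 1)}, by simp⟩

theorem diag_mem_fibreProduct (g : FreeGroup (Fin 2)) : (g, g) ∈ fibreProduct := by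
  induction g using FreeGroup.induction_on with
  | C1 => exact fibreProduct.one_mem
  | of i =>
    fin_cases i
    · exact Subgroup.subset_closure (by simp)
    · exact Subgroup.subset_closure (by simp)
  | inv_of i h => exact fibreProduct.inv_mem h
  | mul x y hx hy => exact fibreProduct.mul_mem hx hy

/-- The action of the free group on `ℤ × ℤ` that factors through `BS(2, 3)`. -/
def permRep : FreeGroup (Fin 2) →* Equiv.Perm (ℤ × ℤ) :=
  FreeGroup.lift ![translationPerm, orbitMatchingPerm]

theorem permRep_relator : permRep relator = 1 := by
  simp [permRep, relator, orbitMatchingPerm_conj_sq]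

theorem permRep_residualWord_ne_one : permRep residualWord ≠ 1 := by
  intro h
  refine not_commute_orbitMatchingPerm_conj (commutatorElement_eq_one_iff_commute.1 ?_)
  simpa [permRep, residualWord, map_commutatorElement] using h

theorem permRep_eq_of_mem_fibreProduct {p : FreeGroup (Fin 2) × FreeGroup (Fin 2)}
    (hp : p ∈ fibreProduct) : permRep p.1 = permRep p.2 := by
  have hle : fibreProduct ≤ (permRep.comp (MonoidHom.fst _ _)).eqLocus
      (permRep.comp (MonoidHom.snd _ _)) := by
    refine (Subgroup.closure_le _).2 ?_
    rintro _ (rfl | rfl | rfl)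
    · rfl
    · rfl
    · exact permRep_relator.trans (map_one permRep).symm
  exact hle hp

/-- In any conjugate of the fibre product, an element (u, 1) has u in the kernel of `permRep`. -/
theorem not_subgroupsConjugate :
    ¬ SubgroupsConjugate fibreProduct residualFibreProduct := by
  rintro ⟨g, hg⟩
  have hw : (residualWord, 1) ∈ residualFibreProduct :=
    Subgroup.mem_sup_right (Subgroup.subset_closure rfl)
  rw [hg] at hw
  obtain ⟨p, hp, hpw⟩ := hw
  have hfst : g.1 * p.1 * g.1⁻¹ = residualWord := congrArg Prod.fst hpw
  have hsnd : g.2 * p.2 * g.2⁻¹ = 1 := congrArg Prod.snd hpw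
  have hp2 : p.2 = 1 := conj_eq_one_iff.1 hsnd
  have hp1 : permRep p.1 = 1 := by
    rw [permRep_eq_of_mem_fibreProduct hp, hp2, map_one]
  refine permRep_residualWord_ne_one ?_
  rw [← hfst, map_mul, map_mul, hp1, mul_one, ← map_mul, mul_inv_cancel, map_one]

/-- The fibre product has the residual word in its closure for the profinite topology. -/
theorem map_residualWord_mem {Q : Type*} [Group Q] [Finite Q]
    (π : FreeGroup (Fin 2) × FreeGroup (Fin 2) →* Q) :
    π (residualWord, 1) ∈ fibreProduct.map π := by
  let R : Subgroup (FreeGroup (Fin 2)) :=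
    (fibreProduct.map π).comap (π.comp (MonoidHom.inl _ _))
  -- The diagonal lies in the fibre product, so conjugation by (g, g) preserves its image. Hence
  -- F₂/R is a finite quotient of BS(2,3).
  have hR : R.Normal := by
    refine ⟨fun u hu g => ?_⟩
    have hg : π (g, g) ∈ fibreProduct.map π :=
      Subgroup.mem_map_of_mem π (diag_mem_fibreProduct g)
    have hmem := mul_mem (mul_mem hg hu) (inv_mem hg)
    change π (g * u * g⁻¹, 1) ∈ fibreProduct.map π
    convert hmem using 1
    simp [← map_mul, ← map_inv]
  have hfin : Finite (FreeGroup (Fin 2) ⧸ R) := by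
    have : R.FiniteIndex := ⟨by
      rw [Subgroup.index_comap]
      exact Subgroup.FiniteIndex.index_ne_zero⟩
    infer_instance
  have hrel : relator ∈ R :=
    Subgroup.mem_map_of_mem π (Subgroup.subset_closure (by simp))
  have hbs : QuotientGroup.mk' R t * QuotientGroup.mk' R a ^ 2 * (QuotientGroup.mk' R t)⁻¹ =
      QuotientGroup.mk' R a ^ 3 := by
    have h1 : QuotientGroup.mk' R relator = 1 := (QuotientGroup.eq_one_iff _).2 hrel
    rw [relator, map_mul, map_inv, mul_inv_eq_one] at h1
    simpa only [map_mul, map_pow, map_inv] using h1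
  have hw : QuotientGroup.mk' R residualWord = 1 := by
    rw [residualWord, map_commutatorElement, commutatorElement_eq_one_iff_commute]
    simpa only [map_mul, map_inv] using commute_conj_of_conj_sq_eq_cube hbs
  exact (QuotientGroup.eq_one_iff residualWord).1 hw

theorem map_residualFibreProduct {Q : Type*} [Group Q] [Finite Q]
    (π : FreeGroup (Fin 2) × FreeGroup (Fin 2) →* Q) :
    residualFibreProduct.map π = fibreProduct.map π := by
  rw [residualFibreProduct, Subgroup.map_sup, sup_eq_left, MonoidHom.map_closure,
    Subgroup.closure_le, Set.image_singleton, Set.singleton_subset_iff]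
  exact map_residualWord_mem π

end BaumslagSolitar

open BaumslagSolitar in
theorem proposition1p5 :
    ¬ SubgroupConjugacySeparable (FreeGroup (Fin 2) × FreeGroup (Fin 2)) := by
  intro hsep
  obtain ⟨N, hN, hfin, hconj⟩ := hsep fibreProduct residualFibreProduct fibreProduct_fg
    residualFibreProduct_fg not_subgroupsConjugate
  refine hconj ⟨1, ?_⟩
  rw [map_residualFibreProduct, map_one]
  exact (Subgroup.map_id _).symm
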